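/- Let $(\Omega,\mathcal A,\mathbb P)$ be a probability space, $\xi^1,\xi^2,\dots$ i.i.d. random variables on it with values in a measurable space $S$ and law $\Xi$, and write $\mathbb E_\xi$ for expectation over $\xi\sim\Xi$. Let $\omega:\mathbb R^n\to\mathbb R\cup\{+\infty\}$ be proper and lower semicontinuous, $\operatorname{dom}\omega=\{x:\omega(x)<\infty\}$. Let $f(x)=\mathbb E_\xi[f(x,\xi)]$, where $f(x,\cdot)$ is $\Xi$-integrable for $x\in\operatorname{dom}\omega$, let $\psi=f+\omega$, and let $f_x(y,s)$ ($x,y\in\mathbb R^n$, $s\in S$) be real-valued model functions, jointly measurable in $(x,y,s)$, with $f_x(y,\cdot)$ $\Xi$-integrable for $x,y\in\operatorname{dom}\omega$. Let $\kappa,\tau,L_\omega,\Lambda\ge 0$, $L_f\in\mathbb R$, $\rho>\kappa+\tau$, and let $\mathcal G:[0,\infty)\to[0,\infty)$ be continuous and non-decreasing. Assume: 1. $\omega$ is $\kappa$-weakly convex, i.e. $\omega+\frac{\kappa}{2}\|\cdot\|^2$ is convex, and $\omega$ is $L_\omega$-Lipschitz on $\operatorname{dom}\omega$. 2. $\mathbb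 E_\xi[f_x(x,\xi)]=f(x)$ for all $x\in\operatorname{dom}\omega$, and $\mathbb E_\xi[f_x(y,\xi)-f(y)]\le\frac{\tau}{2}\|x-y\|^2$ for all $x,y\in\operatorname{dom}\omega$; for $\Xi$-almost every $s$, the function $f_x(\cdot,s)$ is convex on $\operatorname{dom}\omega$ for all $x\in\operatorname{dom}\omega$. 3. There is a measurable $L_f(\cdot):S\to\mathbb R$ with $\mathbb E_\xi[L_f(\xi)^2]\le L_f^2$ such that, for $\Xi$-almost every $s$, $f_x(y,s)-f_x(z,s)\le L_f(s)\,\mathcal G(\|x\|)\,\|y-z\|$ for all $x,y,z\in\mathbb R^n$. 4. The Moreau envelope $\psi_{1/\rho}(x)=\inf_z\{\psi(z)+\frac{\rho}{2}\|z-x\|^2\}$ satisfies $\psi_{1/\rho}\ge-\Lambda$, and all its level sets $\{x:\psi_{1/\rho}(x)\le v\}$, $v\in\mathbb R$, are bounded. Let $\zeta\in(\frac12,1)$, let $x^1\in\operatorname{dom}\omega$ be deterministic, and let $(x^k)_{k\ge1}$ satisfy, almost surely for all $k\ge1$, $$x^{k+1}\in\operatorname*{argmin}_{y\in\mathbb R^n}\Big\{f_{x^k}(y,\xi^k)+\omega(y)+\frac{\gamma_k}{2}\|y-x^k\|^2\Big\},\qquad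 \gamma_k=\rho+\kappa+(\mathcal G(\|x^k\|)+1)\,k^\zeta .$$ Then $\psi_{1/\rho}$ is finite and differentiable on $\mathbb R^n$; almost surely the sequence $\{\|x^k\|\}_{k\ge1}$ is bounded; and almost surely $\inf_{1\le j\le k}\|\nabla\psi_{1/\rho}(x^j)\|\to0$ as $k\to\infty$. -/

import Mathlib

open MeasureTheory ProbabilityTheory Filter Topology
open scoped NNReal

noncomputable section

/-- `n`-dimensional Euclidean space. -/
abbrev Euc (n : ℕ) : Type := EuclideanSpace ℝ (Fin n)

/-- The effective domain of an extended-real-valued function. -/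
def effDomain {n : ℕ} (g : Euc n → EReal) : Set (Euc n) := {x | g x ≠ ⊤}

/-- A proper function never takes the value `-∞` and is finite somewhere. -/
def IsProperFun {n : ℕ} (g : Euc n → EReal) : Prop :=
  (∀ x, g x ≠ ⊥) ∧ (effDomain g).Nonempty

/-- A proper extended-real-valued function `g` is `lam`-weakly convex if `lam ≥ 0` and
`g + (lam / 2) * ‖·‖ ^ 2` is convex, that is, its effective domain is convex and it is convex there
as a real-valued function. -/
def IsWeaklyConvex {n : ℕ} (lam : ℝ) (g : Euc n → EReal) : Prop :=
  0 ≤ lam ∧ ConvexOn ℝ (effDomain g) (fun x => (g x).toReal + lam / 2 * ‖x‖ ^ 2)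

/-- The Moreau envelope `x ↦ inf_z { g z + (ρ / 2) * ‖z - x‖ ^ 2 }`, as an extended real. -/
def moreauEnv {n : ℕ} (g : Euc n → EReal) (ρ : ℝ) (x : Euc n) : EReal :=
  ⨅ z : Euc n, g z + ((ρ / 2 * ‖z - x‖ ^ 2 : ℝ) : EReal)

/-- The expected loss `f x = 𝔼_{s ∼ μ} [F x s]`. -/
def expectedLoss {n : ℕ} {S : Type*} [MeasurableSpace S] (μ : Measure S)
    (F : Euc n → S → ℝ) (x : Euc n) : ℝ := ∫ s, F x s ∂μ

/-- The objective `ψ = f + ω`, where `f` is the expected loss. -/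
def objective {n : ℕ} {S : Type*} [MeasurableSpace S] (μ : Measure S)
    (F : Euc n → S → ℝ) (ω : Euc n → EReal) (x : Euc n) : EReal :=
  (expectedLoss μ F x : EReal) + ω x

/-- The adaptive regularization parameter `ρ + κ + (G ‖x‖ + 1) * k ^ ζ` at iteration `k` and current
iterate `x`. -/
def stepParam {n : ℕ} (ρ κ ζ : ℝ) (G : ℝ≥0 → ℝ≥0) (k : ℕ) (x : Euc n) : ℝ :=
  ρ + κ + ((G ‖x‖₊ : ℝ) + 1) * (k : ℝ) ^ ζ

/-- The function `y ↦ m x y s + ω y + (γ / 2) * ‖y - x‖ ^ 2` minimized in one step of stochastic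
model-based optimization; `m x y s` is the model function `f_x (y, s)`. -/
def subproblem {n : ℕ} {S : Type*} (m : Euc n → Euc n → S → ℝ) (ω : Euc n → EReal)
    (γ : ℝ) (x : Euc n) (s : S) (y : Euc n) : EReal :=
  (m x y s : EReal) + ω y + ((γ / 2 * ‖y - x‖ ^ 2 : ℝ) : EReal)

end

/-! The Lyapunov function is the Moreau envelope shifted by `Λ`. Averaging convex models that touch
`f` at their centre and exceed it by at most `τ/2 ‖x - y‖²` makes `f` `τ`-weakly convex
(`strongConvexOn_loss`), so `ψ` is `(κ + τ)`-weakly convex. As `ρ > κ + τ`, the proximal map `p` is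
single-valued and Lipschitz, and the envelope has gradient `ρ (x - p x)`.

A subproblem is `(γ - κ)`-strongly convex, so its minimizer can be compared with `p x`. Averaging
over the sample (`lintegral_step_le`) shows that the envelope decreases in conditional mean by `ρ (ρ
- κ - τ) / (γ - κ) ‖p x - x‖²`, up to an error of order `(G + 1)² / (γ (γ - κ))`. The factor `G + 1`
in `γ` cancels the unbounded Lipschitz constant: the error is at most a deterministic multiple of
`k^(-2ζ)`, summable because `ζ > 1/2`.

A Robbins–Siegmund argument then bounds the envelope and the accumulated descent almost surely.
Bounded level sets bound the iterates, hence `G` along them, so the descent weights are at least of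
order `k^(-ζ)`. These are not summable since `ζ ≤ 1`, so the gradient norms cannot stay away from
zero.

The given iterates are not assumed measurable. The argument runs on a measurable copy built from
measurable argmin selections; by uniqueness of minimizers the two agree almost surely. -/

open scoped ENNReal

/-- A continuous function with quadratic growth attains its minimum on a closed set. -/
lemma exists_isMinOn_of_quadratic_lower_bound {E : Type*} [NormedAddCommGroup E] [ProperSpace E]
    {D : Set E} (hD : IsClosed D) (hne : D.Nonempty) {g : E → ℝ} (hg : ContinuousOn g D) (x : E)
    (a b : ℝ) {c : ℝ} (hc : 0 < c)
    (hlow : ∀ y ∈ D, a - b * ‖y - x‖ + c * ‖y - x‖ ^ 2 ≤ g y) : ∃ z ∈ D, IsMinOn g D z := by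
  obtain ⟨y₀, hy₀⟩ := hne
  refine hg.exists_isMinOn' hD hy₀ ?_
  have hlim : Tendsto (fun r : ℝ => a + r * (c * r - b)) atTop atTop := by
    refine tendsto_atTop_add_const_left _ _ (tendsto_id.atTop_mul_atTop₀ ?_)
    exact tendsto_atTop_add_const_right _ _ (tendsto_id.const_mul_atTop hc)
  have hn : Tendsto (fun y : E => ‖y - x‖) (cocompact E) atTop := by
    have := tendsto_norm_cocompact_atTop (E := E) |>.comp
      (Homeomorph.subRight x).isClosedEmbedding.tendsto_cocompact
    exact this
  filter_upwards [(hlim.comp hn).eventually_ge_atTop (g y₀) |>.filter_mono inf_le_left,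
    mem_inf_of_right (mem_principal_self D)] with y h1 h2
  have := hlow y h2
  simp only [Function.comp] at h1
  linarith [h1.trans (le_of_eq (by ring :
    a + ‖y - x‖ * (c * ‖y - x‖ - b) = a - b * ‖y - x‖ + c * ‖y - x‖ ^ 2))]

/-! ### Strong and weak convexity -/

section WeakConvexity

variable {E : Type*} [NormedAddCommGroup E] [InnerProductSpace ℝ E]

lemma norm_sq_convex_combination (u v : E) {a b : ℝ} (hab : a + b = 1) :
    ‖a • u + b • v‖ ^ 2 = a * ‖u‖ ^ 2 + b * ‖v‖ ^ 2 - a * b * ‖u - v‖ ^ 2 := by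
  obtain rfl := eq_sub_of_add_eq hab
  rw [norm_add_sq_real, norm_sub_sq_real, norm_smul, norm_smul, real_inner_smul_left,
    real_inner_smul_right, mul_pow, mul_pow, Real.norm_eq_abs, Real.norm_eq_abs, sq_abs, sq_abs]
  ring

lemma strongConvexOn_norm_sub_sq {D : Set E} (hD : Convex ℝ D) (γ : ℝ) (x : E) :
    StrongConvexOn D γ (fun y => γ / 2 * ‖y - x‖ ^ 2) := by
  refine ⟨hD, fun y _ z _ a b _ _ hab => le_of_eq ?_⟩
  have h : a • y + b • z - x = a • (y - x) + b • (z - x) := by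
    obtain rfl := eq_sub_of_add_eq hab
    module
  simp only [h, norm_sq_convex_combination _ _ hab, sub_sub_sub_cancel_right, smul_eq_mul]
  ring

/-- Moduli may be negative: `StrongConvexOn D (-c)` encodes `c`-weak convexity throughout, so that
moduli simply add. -/
lemma StrongConvexOn.add' {D : Set E} {c d : ℝ} {f g : E → ℝ} (hf : StrongConvexOn D c f)
    (hg : StrongConvexOn D d g) : StrongConvexOn D (c + d) (fun x => f x + g x) := by
  have h := UniformConvexOn.add hf hg
  have e : ((fun r : ℝ => c / 2 * r ^ 2) + fun r => d / 2 * r ^ 2) =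
      fun r => (c + d) / 2 * r ^ 2 := by
    funext r
    simp only [Pi.add_apply]
    ring
  rw [e] at h
  exact h

/-- A strongly convex function grows quadratically away from its minimizer. -/
lemma StrongConvexOn.quadratic_growth {D : Set E} {c : ℝ} {g : E → ℝ} (hg : StrongConvexOn D c g)
    {z : E} (hz : z ∈ D) (hmin : IsMinOn g D z) {y : E} (hy : y ∈ D) :
    g z + c / 2 * ‖y - z‖ ^ 2 ≤ g y := by
  -- Convexity along the segment from `z` to `y`, divided by `t`; the factor `1 - t` disappears as
  -- `t → 0`.
  have key : ∀ t ∈ Set.Ioo (0 : ℝ) 1, g z + (1 - t) * (c / 2 * ‖y - z‖ ^ 2) ≤ g y := by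
    intro t ht
    have hc := hg.2 hy hz ht.1.le (sub_nonneg.2 ht.2.le) (by ring)
    have hm : g z ≤ g (t • y + (1 - t) • z) :=
      hmin (hg.1 hy hz ht.1.le (sub_nonneg.2 ht.2.le) (by ring))
    simp only [smul_eq_mul] at hc
    have : t * (g z + (1 - t) * (c / 2 * ‖y - z‖ ^ 2)) ≤ t * g y := by nlinarith
    exact le_of_mul_le_mul_left this ht.1
  have hlim : Tendsto (fun t : ℝ => g z + (1 - t) * (c / 2 * ‖y - z‖ ^ 2)) (𝓝[>] 0)
      (𝓝 (g z + (1 - 0) * (c / 2 * ‖y - z‖ ^ 2))) :=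
    (Continuous.tendsto (by fun_prop) 0).mono_left nhdsWithin_le_nhds
  have hev : ∀ᶠ t : ℝ in 𝓝[>] 0, g z + (1 - t) * (c / 2 * ‖y - z‖ ^ 2) ≤ g y := by
    filter_upwards [Ioo_mem_nhdsGT (zero_lt_one' ℝ)] with t ht using key t ht
  simpa using le_of_tendsto hlim hev

/-- A strongly convex function has at most one minimizer. -/
lemma StrongConvexOn.eq_of_isMinOn {D : Set E} {c : ℝ} {g : E → ℝ} (hg : StrongConvexOn D c g)
    (hc : 0 < c) {z z' : E} (hz : z ∈ D) (hmin : IsMinOn g D z) (hz' : z' ∈ D)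
    (hmin' : IsMinOn g D z') : z = z' := by
  have h1 := hg.quadratic_growth hz hmin hz'
  have h2 : g z' ≤ g z := hmin' hz
  have h3 : ‖z' - z‖ ^ 2 ≤ 0 := by
    by_contra h
    push Not at h
    have := mul_pos (half_pos hc) h
    linarith
  have h4 : ‖z' - z‖ = 0 := by
    have := sq_nonneg ‖z' - z‖
    exact pow_eq_zero_iff two_ne_zero |>.1 (le_antisymm h3 this)
  exact (sub_eq_zero.1 (norm_eq_zero.1 h4)).symm

end WeakConvexity

/-! ### Proximal map and Moreau envelope -/

section ProxValue

variable {E : Type*} [NormedAddCommGroup E] {D : Set E} {φ : E → ℝ} {ρ σ : ℝ} {p : E → E}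

/-- Quadratic growth at `p x` of the function minimized in the Moreau envelope at `x`. -/
def IsProxMap (D : Set E) (φ : E → ℝ) (ρ σ : ℝ) (p : E → E) : Prop :=
  ∀ x, p x ∈ D ∧ ∀ y ∈ D,
    φ (p x) + ρ / 2 * ‖p x - x‖ ^ 2 + σ / 2 * ‖y - p x‖ ^ 2 ≤ φ y + ρ / 2 * ‖y - x‖ ^ 2

/-- The value of the Moreau envelope, in terms of the proximal map. -/
noncomputable def proxValue (φ : E → ℝ) (ρ : ℝ) (p : E → E) (x : E) : ℝ :=
  φ (p x) + ρ / 2 * ‖p x - x‖ ^ 2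

lemma IsProxMap.proxValue_le (hp : IsProxMap D φ ρ σ p) (hσ : 0 < σ) (x : E) {y : E} (hy : y ∈ D) :
    proxValue φ ρ p x ≤ φ y + ρ / 2 * ‖y - x‖ ^ 2 := by
  have := (hp x).2 y hy
  have h2 : 0 ≤ σ / 2 * ‖y - p x‖ ^ 2 := by positivity
  unfold proxValue
  linarith

end ProxValue

section Prox

variable {E : Type*} [NormedAddCommGroup E] [InnerProductSpace ℝ E]

lemma exists_isProxMap [ProperSpace E] {D : Set E} (hD : IsClosed D) (hne : D.Nonempty) {φ : E → ℝ}
    (hφ : ContinuousOn φ D) {c ρ a : ℝ} (hconv : StrongConvexOn D (-c) φ) (hρ : 0 < ρ)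
    (hlow : ∀ y ∈ D, a ≤ φ y) : ∃ p, IsProxMap D φ ρ (ρ - c) p := by
  have h : ∀ x : E, ∃ z ∈ D, IsMinOn (fun y => φ y + ρ / 2 * ‖y - x‖ ^ 2) D z := fun x => by
    refine exists_isMinOn_of_quadratic_lower_bound hD hne
      (hφ.add (Continuous.continuousOn (by fun_prop))) x a 0 (half_pos hρ) fun y hy => ?_
    linarith [hlow y hy]
  choose p hpD hpmin using h
  refine ⟨p, fun x => ⟨hpD x, fun y hy => ?_⟩⟩
  have := (hconv.add' (strongConvexOn_norm_sub_sq hconv.1 ρ x)).quadratic_growth (hpD x)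
    (hpmin x) hy
  rwa [neg_add_eq_sub] at this

variable {D : Set E} {φ : E → ℝ} {ρ σ : ℝ} {p : E → E}

/-- Testing the growth at `x` with `p y` and at `y` with `p x` and adding gives `σ ‖p y - p x‖² ≤ ρ
⟪p y - p x, y - x⟫`; Cauchy–Schwarz finishes. -/
lemma IsProxMap.norm_sub_le (hp : IsProxMap D φ ρ σ p) (hρ : 0 < ρ) (hσ : 0 < σ) (x y : E) :
    ‖p y - p x‖ ≤ ρ / σ * ‖y - x‖ := by
  have h1 := (hp x).2 (p y) (hp y).1
  have h2 := (hp y).2 (p x) (hp x).1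
  rw [norm_sub_rev (p x) (p y)] at h2
  have e : ‖p y - x‖ ^ 2 - ‖p x - x‖ ^ 2 + ‖p x - y‖ ^ 2 - ‖p y - y‖ ^ 2 =
      2 * inner ℝ (p y - p x) (y - x) := by
    simp only [norm_sub_sq_real, inner_sub_left, inner_sub_right]
    ring
  have h3 : σ * ‖p y - p x‖ ^ 2 ≤ ρ * inner ℝ (p y - p x) (y - x) := by
    linear_combination h1 + h2 + ρ / 2 * e
  have h4 := real_inner_le_norm (p y - p x) (y - x)
  rw [div_mul_eq_mul_div, le_div_iff₀ hσ]
  rcases (norm_nonneg (p y - p x)).eq_or_lt with h0 | h0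
  · rw [← h0]
    simp only [zero_mul]
    positivity
  · refine le_of_mul_le_mul_left ?_ h0
    nlinarith [mul_le_mul_of_nonneg_left h4 hρ.le]

/-- `p x` is an admissible trial point for the envelope at `y`. -/
lemma IsProxMap.proxValue_sub_le (hp : IsProxMap D φ ρ σ p) (hσ : 0 < σ) (x y : E) :
    proxValue φ ρ p y - proxValue φ ρ p x ≤
      ρ * inner ℝ (x - p x) (y - x) + ρ / 2 * ‖y - x‖ ^ 2 := by
  have h := hp.proxValue_le hσ y (hp x).1
  have e : ‖p x - y‖ ^ 2 = ‖p x - x‖ ^ 2 + 2 * inner ℝ (x - p x) (y - x) + ‖y - x‖ ^ 2 := by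
    have : p x - y = -((x - p x) + (y - x)) := by abel
    rw [this, norm_neg, norm_add_sq_real, norm_sub_rev x]
  rw [e] at h
  unfold proxValue at h ⊢
  linarith

variable [CompleteSpace E]

/-- The Moreau envelope is differentiable, with gradient `ρ (x - p x)`. -/
lemma IsProxMap.hasGradientAt (hp : IsProxMap D φ ρ σ p) (hρ : 0 < ρ) (hσ : 0 < σ) (x : E) :
    HasGradientAt (proxValue φ ρ p) (ρ • (x - p x)) x := by
  rw [hasGradientAt_iff_isLittleO]
  have hO : (fun y => proxValue φ ρ p y - proxValue φ ρ p x - inner ℝ (ρ • (x - p x)) (y - x))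
      =O[𝓝 x] fun y => ‖y - x‖ ^ 2 := by
    -- The upper bound is `proxValue_sub_le`; the lower bound is the same with `x` and `y`
    -- exchanged. Moving the gradient back from `y` to `x` costs `ρ ⟪p y - p x, y - x⟫`, whence `ρ *
    -- (ρ / σ)`.
    refine Asymptotics.IsBigO.of_bound (ρ / 2 + ρ * (ρ / σ)) (Eventually.of_forall fun y => ?_)
    have h1 := hp.proxValue_sub_le hσ x y
    have h2 := hp.proxValue_sub_le hσ y x
    have e : inner ℝ (y - p y) (x - y) =
        -inner ℝ (x - p x) (y - x) - ‖y - x‖ ^ 2 + inner ℝ (p y - p x) (y - x) := by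
      rw [← real_inner_self_eq_norm_sq (y - x)]
      simp only [inner_sub_left, inner_sub_right]
      ring
    have h3 : inner ℝ (p y - p x) (y - x) ≤ ρ / σ * ‖y - x‖ ^ 2 := by
      refine (real_inner_le_norm _ _).trans ?_
      calc ‖p y - p x‖ * ‖y - x‖ ≤ (ρ / σ * ‖y - x‖) * ‖y - x‖ := by
            gcongr
            exact hp.norm_sub_le hρ hσ x y
        _ = _ := by ring
    have h4 : 0 ≤ ρ * (ρ / σ) * ‖y - x‖ ^ 2 := by positivity
    have h5 := mul_le_mul_of_nonneg_left h3 hρ.le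
    have h6 : 0 ≤ ρ * ‖y - x‖ ^ 2 := by positivity
    rw [norm_sub_rev x y, e] at h2
    rw [real_inner_smul_left, Real.norm_eq_abs, Real.norm_of_nonneg (by positivity), abs_le]
    constructor <;> nlinarith
  refine hO.trans_isLittleO ?_
  have h0 : Tendsto (fun y => y - x) (𝓝 x) (𝓝 0) := tendsto_sub_nhds_zero_iff.2 tendsto_id
  have := (Asymptotics.isLittleO_norm_pow_id (E' := E) one_lt_two).comp_tendsto h0
  exact this

end Prox

/-! ### Independence and almost supermartingales -/

section Probability

/-- Integrating out a random variable `Y` that is independent of the past `m₀`. -/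
lemma setLIntegral_comp_of_indep {Ω E S : Type*} [MeasurableSpace E] [MeasurableSpace S]
    {m₀ mΩ : MeasurableSpace Ω} {P : Measure Ω} [IsFiniteMeasure P] (hm₀ : m₀ ≤ mΩ) {X : Ω → E}
    (hX : Measurable[m₀] X) {Y : Ω → S} (hY : Measurable Y)
    (hind : Indep m₀ (MeasurableSpace.comap Y inferInstance) P) {h : E × S → ℝ≥0∞}
    (hh : Measurable h) {A : Set Ω} (hA : MeasurableSet[m₀] A) :
    ∫⁻ w in A, h (X w, Y w) ∂P = ∫⁻ w in A, ∫⁻ s, h (X w, s) ∂(P.map Y) ∂P := by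
  -- Carrying the indicator of `A` along with the state turns the set integral into a full one, to
  -- which Fubini for the product law applies.
  let X' : Ω → E × ℝ≥0∞ := fun w => (X w, A.indicator (fun _ => 1) w)
  have hX'₀ : Measurable[m₀] X' :=
    hX.prodMk (Measurable.indicator measurable_const hA)
  have hX' : Measurable X' := hX'₀.mono hm₀ le_rfl
  have hindep : IndepFun X' Y P := indep_of_indep_of_le_left hind hX'₀.comap_le
  let g : (E × ℝ≥0∞) × S → ℝ≥0∞ := fun q => q.1.2 * h (q.1.1, q.2)
  have hg : Measurable g := by fun_prop
  have h1 : ∫⁻ w, g (X' w, Y w) ∂P = ∫⁻ w, ∫⁻ s, g (X' w, s) ∂(P.map Y) ∂P := by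
    rw [← lintegral_map (f := g) (g := fun w => (X' w, Y w)) hg (hX'.prodMk hY),
      hindep.map_prod_eq_prod_map_map hX'.aemeasurable hY.aemeasurable,
      lintegral_prod _ hg.aemeasurable, lintegral_map hg.lintegral_prod_right' hX']
  have hA' : MeasurableSet A := hm₀ A hA
  rw [← lintegral_indicator hA', ← lintegral_indicator hA']
  convert h1 using 2
  · funext w
    by_cases hw : w ∈ A <;> simp [g, X', hw]
  · funext w
    by_cases hw : w ∈ A <;> simp [g, X', hw]

/-- A form of the Robbins–Siegmund theorem: a nonnegative adapted process which decreases in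
conditional mean by `a k`, up to summable errors `c k`, is almost surely bounded, as are the partial
sums of the decrements. -/
theorem ae_bounded_of_almost_supermartingale {Ω : Type*} {mΩ : MeasurableSpace Ω}
    {P : Measure Ω} [IsFiniteMeasure P] {ℱ : Filtration ℕ mΩ} {V a : ℕ → Ω → ℝ} {c : ℕ → ℝ}
    (hV : ∀ k, Measurable[ℱ k] (V k))
    (ha : ∀ k, Measurable[ℱ k] (a k)) (hV0 : ∀ k w, 0 ≤ V k w) (ha0 : ∀ k w, 0 ≤ a k w)
    (hc0 : ∀ k, 0 ≤ c k) (hc : Summable c) (hint : ∫⁻ w, ENNReal.ofReal (V 0 w) ∂P ≠ ∞)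
    (hstep : ∀ k A, MeasurableSet[ℱ k] A →
      ∫⁻ w in A, ENNReal.ofReal (V (k + 1) w) ∂P + ∫⁻ w in A, ENNReal.ofReal (a k w) ∂P ≤
        ∫⁻ w in A, ENNReal.ofReal (V k w) ∂P + ENNReal.ofReal (c k) * P A) :
    ∀ᵐ w ∂P, ∃ B, ∀ k, V k w + ∑ i ∈ Finset.range k, a i w ≤ B := by
  have hVm : ∀ k, Measurable (V k) := fun k => (hV k).mono (ℱ.le k) le_rfl
  have ham : ∀ k, Measurable (a k) := fun k => (ha k).mono (ℱ.le k) le_rfl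
  have hfin : ∀ k, ∫⁻ w, ENNReal.ofReal (V k w) ∂P ≠ ∞ := by
    intro k
    induction k with
    | zero => exact hint
    | succ k ih =>
      have h := hstep k Set.univ MeasurableSet.univ
      simp only [Measure.restrict_univ] at h
      exact ne_top_of_le_ne_top (ENNReal.add_ne_top.2
        ⟨ih, ENNReal.mul_ne_top ENNReal.ofReal_ne_top (measure_ne_top _ _)⟩)
        (le_self_add.trans h)
  have hVi : ∀ k, Integrable (V k) P := fun k =>
    ⟨(hVm k).aestronglyMeasurable, by
      rw [hasFiniteIntegral_iff_ofReal (Eventually.of_forall (hV0 k))]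
      exact (hfin k).lt_top⟩
  have hai : ∀ k, Integrable (a k) P := fun k =>
    ⟨(ham k).aestronglyMeasurable, by
      rw [hasFiniteIntegral_iff_ofReal (Eventually.of_forall (ha0 k))]
      have h := hstep k Set.univ MeasurableSet.univ
      simp only [Measure.restrict_univ] at h
      exact lt_of_le_of_lt (le_add_self.trans h) (ENNReal.add_lt_top.2
        ⟨(hfin k).lt_top, ENNReal.mul_lt_top ENNReal.ofReal_lt_top (measure_lt_top _ _)⟩)⟩
  have hreal : ∀ k A, MeasurableSet[ℱ k] A →
      ∫ w in A, V (k + 1) w ∂P + ∫ w in A, a k w ∂P ≤ ∫ w in A, V k w ∂P + c k * P.real A := by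
    intro k A hA
    have h := hstep k A hA
    have hAr : ENNReal.ofReal (P.real A) = P A := ofReal_measureReal
    rw [← ofReal_integral_eq_lintegral_ofReal (hVi _).integrableOn
        (Eventually.of_forall (hV0 _)),
      ← ofReal_integral_eq_lintegral_ofReal (hVi _).integrableOn (Eventually.of_forall (hV0 _)),
      ← ofReal_integral_eq_lintegral_ofReal (hai _).integrableOn (Eventually.of_forall (ha0 _)),
      ← hAr, ← ENNReal.ofReal_mul (hc0 k),
      ← ENNReal.ofReal_add (integral_nonneg (hV0 _)) (integral_nonneg (ha0 _)),
      ← ENNReal.ofReal_add (integral_nonneg (hV0 _))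
        (mul_nonneg (hc0 k) measureReal_nonneg)] at h
    exact (ENNReal.ofReal_le_ofReal_iff (add_nonneg (integral_nonneg (hV0 _))
        (mul_nonneg (hc0 k) measureReal_nonneg))).1 h
  -- Adding the tail of the errors makes a true supermartingale that stays nonnegative, so `-M` is
  -- an `L¹`-bounded submartingale and converges.
  let M : ℕ → Ω → ℝ := fun k w => V k w + ∑ i ∈ Finset.range k, a i w +
    (∑' i, c i - ∑ i ∈ Finset.range k, c i)
  have hrem : ∀ k, 0 ≤ ∑' i, c i - ∑ i ∈ Finset.range k, c i := fun k =>
    sub_nonneg.2 (hc.sum_le_tsum _ fun i _ => hc0 i)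
  have hM0 : ∀ k w, 0 ≤ M k w := fun k w =>
    add_nonneg (add_nonneg (hV0 k w) (Finset.sum_nonneg fun i _ => ha0 i w)) (hrem k)
  have hMi : ∀ k, Integrable (M k) P := fun k =>
    ((hVi k).add (integrable_finsetSum _ fun i _ => hai i)).add (integrable_const _)
  have hMsucc : ∀ k w, M (k + 1) w = M k w + (V (k + 1) w + a k w - V k w - c k) := by
    intro k w
    simp only [M, Finset.sum_range_succ]
    ring
  have hadp : StronglyAdapted ℱ M := fun k => by
    have h : Measurable[ℱ k] (M k) := by
      refine Measurable.add (Measurable.add (hV k) ?_) measurable_const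
      exact Finset.measurable_fun_sum _ fun i hi =>
        (ha i).mono (ℱ.mono (Finset.mem_range.1 hi).le) le_rfl
    exact h.stronglyMeasurable
  have hset : ∀ k A, MeasurableSet[ℱ k] A → ∫ w in A, M (k + 1) w ∂P ≤ ∫ w in A, M k w ∂P := by
    intro k A hA
    simp only [hMsucc]
    have i1 : Integrable (fun w => V (k + 1) w + a k w) (P.restrict A) :=
      ((hVi _).add (hai _)).integrableOn
    have i2 : Integrable (fun w => V (k + 1) w + a k w - V k w) (P.restrict A) :=
      i1.sub (hVi _).integrableOn
    have i3 : Integrable (fun w => V (k + 1) w + a k w - V k w - c k) (P.restrict A) :=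
      i2.sub (integrable_const _)
    rw [integral_add (hMi k).integrableOn i3,
      integral_sub i2 (integrable_const _), integral_sub i1 (hVi _).integrableOn,
      integral_add (hVi _).integrableOn (hai _).integrableOn, setIntegral_const, smul_eq_mul]
    linarith [hreal k A hA]
  have hsuper : Supermartingale M ℱ P := supermartingale_of_setIntegral_succ_le hadp hMi hset
  have hmean : ∀ k, ∫ w, M k w ∂P ≤ ∫ w, M 0 w ∂P := by
    intro k
    have := hsuper.setIntegral_le (Nat.zero_le k) MeasurableSet.univ
    simpa using this
  have hbdd : ∀ k, eLpNorm ((-M) k) 1 P ≤ (Real.toNNReal (∫ w, M 0 w ∂P) : ℝ≥0) := by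
    intro k
    rw [Pi.neg_apply, eLpNorm_neg, eLpNorm_one_eq_lintegral_enorm]
    have : ∀ w, ‖M k w‖ₑ = ENNReal.ofReal (M k w) := fun w => Real.enorm_of_nonneg (hM0 k w)
    simp only [this]
    rw [← ofReal_integral_eq_lintegral_ofReal (hMi k) (Eventually.of_forall (hM0 k))]
    exact ENNReal.ofReal_le_ofReal (hmean k)
  filter_upwards [hsuper.neg.ae_tendsto_limitProcess hbdd] with w hw
  obtain ⟨B, hB⟩ := hw.bddBelow_range
  refine ⟨-B, fun k => ?_⟩
  have := hB ⟨k, rfl⟩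
  simp only [Pi.neg_apply, M] at this
  linarith [hrem k]

end Probability

/-! ### Measurable selection of minimizers -/

section MeasurableSelection

/-- Minimizers with quadratic growth can be selected measurably in the parameter. -/
lemma exists_measurable_argmin {α E : Type*} [MeasurableSpace α] [NormedAddCommGroup E]
    [SecondCountableTopology E] [MeasurableSpace E] [BorelSpace E] {D : Set E} (hne : D.Nonempty)
    {Φ : α → E → ℝ} (hΦ : ∀ y ∈ D, Measurable fun a => Φ a y) {K : Set α} (hK : MeasurableSet K)
    (hcont : ∀ a ∈ K, ContinuousOn (Φ a) D)
    (hmin : ∀ a ∈ K, ∃ z ∈ D, ∃ c > 0, ∀ y ∈ D, Φ a z + c * ‖y - z‖ ^ 2 ≤ Φ a y) :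
    ∃ T : α → E, Measurable T ∧ (∀ a, T a ∈ D) ∧ ∀ a ∈ K, IsMinOn (Φ a) D (T a) := by
  classical
  have : Nonempty D := hne.to_subtype
  let d : ℕ → D := TopologicalSpace.denseSeq D
  have hd : DenseRange d := TopologicalSpace.denseRange_denseSeq D
  choose! z hzD c hc hz using hmin
  have happrox : ∀ a ∈ K, ∀ b, (∃ y ∈ D, Φ a y < b) → ∃ i, Φ a (d i) < b := by
    rintro a ha b ⟨y, hy, hyb⟩
    have hcr : Continuous (D.domRestrict (Φ a)) :=
      continuousOn_iff_continuous_domRestrict.1 (hcont a ha)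
    exact hd.exists_mem_open (hcr.isOpen_preimage _ isOpen_Iio) ⟨⟨y, hy⟩, hyb⟩
  -- `d N` is `1/(j+1)`-optimal among the dense points. Off `K` the condition is vacuous, so the
  -- least index is `0`. Quadratic growth makes the near-minimizers converge.
  let p : ℕ → α → ℕ → Prop := fun j a N => a ∈ K → ∀ i, Φ a (d N) ≤ Φ a (d i) + 1 / ((j : ℝ) + 1)
  have hpos : ∀ j : ℕ, (0 : ℝ) < 1 / ((j : ℝ) + 1) := fun j => Nat.one_div_pos_of_nat
  have hp : ∀ j a, ∃ N, p j a N := by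
    intro j a
    by_cases ha : a ∈ K
    · obtain ⟨N, hN⟩ := happrox a ha (Φ a (z a) + 1 / ((j : ℝ) + 1))
        ⟨z a, hzD a ha, by linarith [hpos j]⟩
      refine ⟨N, fun _ i => hN.le.trans ?_⟩
      have := hz a ha (d i) (d i).2
      have h2 : 0 ≤ c a * ‖(d i : E) - z a‖ ^ 2 := mul_nonneg (hc a ha).le (sq_nonneg _)
      linarith
    · exact ⟨0, fun h => absurd h ha⟩
  have hpm : ∀ j N, MeasurableSet {a | p j a N} := by
    intro j N
    have : {a | p j a N} =
        Kᶜ ∪ ⋂ i, {a | Φ a (d N) ≤ Φ a (d i) + 1 / ((j : ℝ) + 1)} := by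
      ext a
      simp only [p, Set.mem_ofPred_eq, Set.mem_union, Set.mem_compl_iff, Set.mem_iInter]
      tauto
    rw [this]
    exact hK.compl.union (MeasurableSet.iInter fun i =>
      measurableSet_le (hΦ _ (d N).2) ((hΦ _ (d i).2).add_const _))
  let u : ℕ → α → E := fun j a => d (Nat.find (hp j a))
  have hum : ∀ j, Measurable (u j) := fun j =>
    (measurable_from_top (f := fun i => (d i : E))).comp (measurable_find (hp j) (hpm j))
  have hu : ∀ j a, a ∈ K → c a * ‖u j a - z a‖ ^ 2 ≤ 1 / ((j : ℝ) + 1) := by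
    intro j a ha
    have h1 := hz a ha (u j a) (d _).2
    have h2 : Φ a (u j a) ≤ Φ a (z a) + 1 / ((j : ℝ) + 1) := by
      by_contra! h
      obtain ⟨i, hi⟩ := happrox a ha (Φ a (u j a) - 1 / ((j : ℝ) + 1))
        ⟨z a, hzD a ha, by linarith⟩
      have := Nat.find_spec (hp j a) ha i
      simp only [u] at hi
      linarith
    linarith
  let T : α → E := fun a => if a ∈ K then z a else d 0
  have hlim : ∀ a, Tendsto (fun j => u j a) atTop (𝓝 (T a)) := by
    intro a
    by_cases ha : a ∈ K
    · simp only [T, ha, if_true]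
      rw [tendsto_iff_norm_sub_tendsto_zero]
      have h1 : Tendsto (fun j : ℕ => 1 / ((j : ℝ) + 1) / c a) atTop (𝓝 0) := by
        simpa using (tendsto_one_div_add_atTop_nhds_zero_nat (𝕜 := ℝ)).div_const (c a)
      have h2 : Tendsto (fun j => ‖u j a - z a‖ ^ 2) atTop (𝓝 0) :=
        squeeze_zero (fun _ => sq_nonneg _)
          (fun j => (le_div_iff₀' (hc a ha)).2 (hu j a ha)) h1
      have h3 := h2.sqrt
      simpa [Real.sqrt_sq] using h3
    · have : ∀ j, u j a = d 0 := by
        intro j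
        have : Nat.find (hp j a) = 0 := (Nat.find_eq_zero _).2 fun h => absurd h ha
        simp [u, this]
      simp only [T, ha, if_false, this]
      exact tendsto_const_nhds
  refine ⟨T, measurable_of_tendsto_metrizable hum (tendsto_pi_nhds.2 hlim), fun a => ?_,
    fun a ha y hy => ?_⟩
  · by_cases ha : a ∈ K
    · simpa [T, ha] using hzD a ha
    · simp [T, ha]
  · have h1 := hz a ha y hy
    have h2 : 0 ≤ c a * ‖y - z a‖ ^ 2 := mul_nonneg (hc a ha).le (sq_nonneg _)
    simp only [T, ha, if_true, Set.mem_ofPred_eq]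
    linarith

end MeasurableSelection

/-! ### Expected descent in one step -/

section StochasticModel

variable {E S : Type*} [NormedAddCommGroup E] [InnerProductSpace ℝ E]
  [MeasurableSpace E] [MeasurableSpace S]

/-- Real-valued form of the standing assumptions on the loss `f`, the regularizer `r` with domain
`D`, the models `m` and the growth function `g`. -/
structure IsStochasticModel (μ : Measure S) (D : Set E) (f r : E → ℝ) (m : E → E → S → ℝ)
    (g : E → ℝ) (L : S → ℝ) (ρ κ τ ℓ Λ : ℝ) : Prop where
  nonempty : D.Nonempty
  isClosed : IsClosed D
  kappa_nonneg : 0 ≤ κ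
  tau_nonneg : 0 ≤ τ
  lip_nonneg : 0 ≤ ℓ
  lt_rho : κ + τ < ρ
  reg_conv : StrongConvexOn D (-κ) r
  reg_lip : ∀ x ∈ D, ∀ y ∈ D, r x - r y ≤ ℓ * ‖x - y‖
  measurable : Measurable fun q : E × E × S => m q.1 q.2.1 q.2.2
  integrable : ∀ x ∈ D, ∀ y ∈ D, Integrable (m x y) μ
  exact : ∀ x ∈ D, ∫ s, m x x s ∂μ = f x
  quad : ∀ x ∈ D, ∀ y ∈ D, ∫ s, m x y s ∂μ ≤ f y + τ / 2 * ‖x - y‖ ^ 2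
  conv : ∀ᵐ s ∂μ, ∀ x ∈ D, ConvexOn ℝ D fun y => m x y s
  lip : ∀ᵐ s ∂μ, ∀ x y z, m x y s - m x z s ≤ |L s| * g x * ‖y - z‖
  growth_cont : Continuous g
  growth_nonneg : ∀ x, 0 ≤ g x
  memLp : MemLp L 2 μ
  lower : ∀ y ∈ D, -Λ ≤ f y + r y

/-- The squared length of the proximal step at `x`, weighted by `ρ σ / (γ - κ)`. -/
noncomputable def descentTerm (ρ σ κ γ : ℝ) (p : E → E) (x : E) : ℝ :=
  ρ * σ / (γ - κ) * ‖p x - x‖ ^ 2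

namespace IsStochasticModel

variable {μ : Measure S} {D : Set E} {f r : E → ℝ} {m : E → E → S → ℝ} {g : E → ℝ} {L : S → ℝ}
  {ρ κ τ ℓ Λ : ℝ}

lemma rho_pos (h : IsStochasticModel μ D f r m g L ρ κ τ ℓ Λ) : 0 < ρ := by
  linarith [h.kappa_nonneg, h.tau_nonneg, h.lt_rho]

lemma integrable_abs [IsFiniteMeasure μ] (h : IsStochasticModel μ D f r m g L ρ κ τ ℓ Λ) :
    Integrable (fun s => |L s|) μ := (h.memLp.integrable one_le_two).abs

lemma integrable_sq [IsFiniteMeasure μ] (h : IsStochasticModel μ D f r m g L ρ κ τ ℓ Λ) :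
    Integrable (fun s => (|L s| + ℓ) ^ 2) μ := by
  have : MemLp (fun s => |L s| + ℓ) 2 μ := h.memLp.abs.add (memLp_const ℓ)
  exact this.integrable_sq

/-- The model centred at `x` is exact in mean there, is Lipschitz, and overestimates `f y` by at
most the quadratic term. -/
lemma loss_sub_le [IsFiniteMeasure μ] (h : IsStochasticModel μ D f r m g L ρ κ τ ℓ Λ) {x y : E}
    (hx : x ∈ D) (hy : y ∈ D) :
    f x - f y ≤ (∫ s, |L s| ∂μ) * g x * ‖x - y‖ + τ / 2 * ‖x - y‖ ^ 2 := by
  have h1 : ∫ s, m x x s - m x y s ∂μ ≤ ∫ s, |L s| * (g x * ‖x - y‖) ∂μ := by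
    refine integral_mono_ae ((h.integrable x hx x hx).sub (h.integrable x hx y hy))
      (h.integrable_abs.mul_const _) ?_
    filter_upwards [h.lip] with s hs
    linarith [hs x x y]
  rw [integral_sub (h.integrable x hx x hx) (h.integrable x hx y hy), integral_mul_const,
    h.exact x hx] at h1
  linarith [h.quad x hx y hy]

lemma continuousOn_loss [IsFiniteMeasure μ] (h : IsStochasticModel μ D f r m g L ρ κ τ ℓ Λ) :
    ContinuousOn f D := by
  intro x hx
  have hJ : 0 ≤ ∫ s, |L s| ∂μ := integral_nonneg fun _ => abs_nonneg _
  have hb : ∀ y ∈ D, ‖f y - f x‖ ≤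
      (∫ s, |L s| ∂μ) * (g x + g y) * ‖x - y‖ + τ / 2 * ‖x - y‖ ^ 2 := by
    intro y hy
    have h1 := h.loss_sub_le hx hy
    have h2 := h.loss_sub_le hy hx
    rw [norm_sub_rev y x] at h2
    have h3 := mul_nonneg (mul_nonneg hJ (h.growth_nonneg x)) (norm_nonneg (x - y))
    have h4 := mul_nonneg (mul_nonneg hJ (h.growth_nonneg y)) (norm_nonneg (x - y))
    rw [Real.norm_eq_abs, abs_le]
    constructor <;> nlinarith
  rw [ContinuousWithinAt, tendsto_iff_norm_sub_tendsto_zero]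
  refine squeeze_zero' (Eventually.of_forall fun _ => norm_nonneg _)
    (eventually_nhdsWithin_of_forall hb) ?_
  have hg := h.growth_cont
  have hcont : Continuous fun y =>
      (∫ s, |L s| ∂μ) * (g x + g y) * ‖x - y‖ + τ / 2 * ‖x - y‖ ^ 2 := by fun_prop
  have := hcont.tendsto x
  simp only [sub_self, norm_zero, mul_zero, zero_pow two_ne_zero, add_zero] at this
  exact this.mono_left nhdsWithin_le_nhds

lemma continuousOn_reg (h : IsStochasticModel μ D f r m g L ρ κ τ ℓ Λ) : ContinuousOn r D := by
  have : LipschitzOnWith (Real.toNNReal ℓ) r D := LipschitzOnWith.of_dist_le_mul fun x hx y hy => by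
    rw [Real.coe_toNNReal _ h.lip_nonneg, Real.dist_eq, dist_eq_norm, abs_le]
    have h1 := h.reg_lip x hx y hy
    have h2 := h.reg_lip y hy x hx
    rw [norm_sub_rev y x] at h2
    constructor <;> linarith
  exact this.continuousOn

/-- The model is centred at the convex combination `w` itself: exact there, convex, and above `f` by
at most the quadratic error at the endpoints. Those errors add up by `a b² + b a² = a b`. -/
lemma strongConvexOn_loss (h : IsStochasticModel μ D f r m g L ρ κ τ ℓ Λ) :
    StrongConvexOn D (-τ) f := by
  refine ⟨h.reg_conv.1, fun y hy z hz a b ha hb hab => ?_⟩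
  have hw : a • y + b • z ∈ D := h.reg_conv.1 hy hz ha hb hab
  set w := a • y + b • z with hwdef
  have h1 : ∫ s, m w w s ∂μ ≤ ∫ s, a * m w y s + b * m w z s ∂μ := by
    refine integral_mono_ae (h.integrable w hw w hw)
      (((h.integrable w hw y hy).const_mul a).add ((h.integrable w hw z hz).const_mul b)) ?_
    filter_upwards [h.conv] with s hs
    exact (hs w hw).2 hy hz ha hb hab
  rw [integral_add ((h.integrable w hw y hy).const_mul a) ((h.integrable w hw z hz).const_mul b),
    integral_const_mul, integral_const_mul, h.exact w hw] at h1
  have h2 := mul_le_mul_of_nonneg_left (h.quad w hw y hy) ha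
  have h3 := mul_le_mul_of_nonneg_left (h.quad w hw z hz) hb
  have e1 : ‖w - y‖ ^ 2 = b ^ 2 * ‖y - z‖ ^ 2 := by
    have : w - y = b • (z - y) := by
      rw [hwdef, eq_sub_of_add_eq hab]
      module
    rw [this, norm_smul, mul_pow, Real.norm_eq_abs, sq_abs, norm_sub_rev]
  have e2 : ‖w - z‖ ^ 2 = a ^ 2 * ‖y - z‖ ^ 2 := by
    have : w - z = a • (y - z) := by
      rw [hwdef, eq_sub_of_add_eq' hab]
      module
    rw [this, norm_smul, mul_pow, Real.norm_eq_abs, sq_abs]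
  rw [e1] at h2
  rw [e2] at h3
  simp only [smul_eq_mul]
  refine (h1.trans (add_le_add h2 h3)).trans (le_of_eq ?_)
  rw [eq_sub_of_add_eq hab]
  ring

lemma strongConvexOn_objective (h : IsStochasticModel μ D f r m g L ρ κ τ ℓ Λ) :
    StrongConvexOn D (-(κ + τ)) fun y => f y + r y := by
  have := h.strongConvexOn_loss.add' h.reg_conv
  rwa [show -τ + -κ = -(κ + τ) by ring] at this

lemma exists_prox [ProperSpace E] [IsFiniteMeasure μ]
    (h : IsStochasticModel μ D f r m g L ρ κ τ ℓ Λ) :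
    ∃ p, IsProxMap D (fun y => f y + r y) ρ (ρ - (κ + τ)) p :=
  exists_isProxMap h.isClosed h.nonempty (h.continuousOn_loss.add h.continuousOn_reg)
    h.strongConvexOn_objective h.rho_pos h.lower

/-- The function minimized in a step from `x` with sample `s` is strongly convex on `D`. -/
lemma strongConvexOn_step (h : IsStochasticModel μ D f r m g L ρ κ τ ℓ Λ) {s : S}
    {x : E} (hs : ConvexOn ℝ D fun y => m x y s) (γ : ℝ) :
    StrongConvexOn D (γ - κ) fun y => m x y s + r y + γ / 2 * ‖y - x‖ ^ 2 := by
  have := ((strongConvexOn_zero.2 hs).add' h.reg_conv).add'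
    (strongConvexOn_norm_sub_sq h.reg_conv.1 γ x)
  rwa [show 0 + -κ + γ = γ - κ by ring] at this

lemma continuousOn_step (h : IsStochasticModel μ D f r m g L ρ κ τ ℓ Λ) {s : S} {x : E}
    (hs : ∀ y z, m x y s - m x z s ≤ |L s| * g x * ‖y - z‖) (γ : ℝ) :
    ContinuousOn (fun y => m x y s + r y + γ / 2 * ‖y - x‖ ^ 2) D := by
  have hk : 0 ≤ |L s| * g x := mul_nonneg (abs_nonneg _) (h.growth_nonneg x)
  have : LipschitzWith (Real.toNNReal (|L s| * g x)) fun y => m x y s :=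
    LipschitzWith.of_dist_le_mul fun y z => by
      rw [Real.coe_toNNReal _ hk, Real.dist_eq, dist_eq_norm, abs_le]
      have h1 := hs y z
      have h2 := hs z y
      rw [norm_sub_rev z y] at h2
      constructor <;> linarith
  exact (this.continuous.continuousOn.add h.continuousOn_reg).add
    (Continuous.continuousOn (by fun_prop))

lemma exists_isMinOn_step [ProperSpace E] (h : IsStochasticModel μ D f r m g L ρ κ τ ℓ Λ)
    {s : S} {x : E}
    (hx : x ∈ D) (hs : ∀ y z, m x y s - m x z s ≤ |L s| * g x * ‖y - z‖) {γ : ℝ} (hγ : 0 < γ) :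
    ∃ z ∈ D, IsMinOn (fun y => m x y s + r y + γ / 2 * ‖y - x‖ ^ 2) D z := by
  refine exists_isMinOn_of_quadratic_lower_bound h.isClosed h.nonempty (h.continuousOn_step hs γ) x
    (m x x s + r x) (|L s| * g x + ℓ) (half_pos hγ) fun y hy => ?_
  have h1 := hs x y
  have h2 := h.reg_lip x hx y hy
  rw [norm_sub_rev x y] at h1 h2
  linarith

/-- Descent of the Moreau envelope along a step, for a fixed sample. -/
lemma proxValue_step_le (h : IsStochasticModel μ D f r m g L ρ κ τ ℓ Λ) {p : E → E}
    (hp : IsProxMap D (fun y => f y + r y) ρ (ρ - (κ + τ)) p) {s : S} {x z : E} (hx : x ∈ D)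
    (hsc : ConvexOn ℝ D fun y => m x y s)
    (hs : ∀ y z, m x y s - m x z s ≤ |L s| * g x * ‖y - z‖) {γ : ℝ} (hγ : κ < γ) (hz : z ∈ D)
    (hmin : IsMinOn (fun y => m x y s + r y + γ / 2 * ‖y - x‖ ^ 2) D z) :
    proxValue (fun y => f y + r y) ρ p z ≤ f (p x) + r (p x) + ρ / (γ - κ) *
      (m x (p x) s - m x x s + r (p x) - r x + (g x + 1) ^ 2 / (2 * γ) * (|L s| + ℓ) ^ 2
        + γ / 2 * ‖p x - x‖ ^ 2) := by
  have hγ0 : 0 < γ := h.kappa_nonneg.trans_lt hγ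
  have h1 := (h.strongConvexOn_step hsc γ).quadratic_growth hz hmin (hp x).1
  have h2 := hs x z
  have h3 := h.reg_lip x hx z hz
  have hg := h.growth_nonneg x
  have hℓ := h.lip_nonneg
  have h4 : |L s| * g x + ℓ ≤ (g x + 1) * (|L s| + ℓ) := by
    nlinarith [abs_nonneg (L s), mul_nonneg hg hℓ]
  -- Young's inequality; its quadratic part cancels the proximal term at `z`.
  have h5 : (g x + 1) * (|L s| + ℓ) * ‖x - z‖ ≤
      (g x + 1) ^ 2 / (2 * γ) * (|L s| + ℓ) ^ 2 + γ / 2 * ‖x - z‖ ^ 2 := by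
    have e : (g x + 1) ^ 2 / (2 * γ) * (|L s| + ℓ) ^ 2 + γ / 2 * ‖x - z‖ ^ 2 -
        (g x + 1) * (|L s| + ℓ) * ‖x - z‖ =
        ((g x + 1) * (|L s| + ℓ) - γ * ‖x - z‖) ^ 2 / (2 * γ) := by
      field_simp
      ring
    have : 0 ≤ ((g x + 1) * (|L s| + ℓ) - γ * ‖x - z‖) ^ 2 / (2 * γ) := by positivity
    linarith
  have h6 : (|L s| * g x + ℓ) * ‖x - z‖ ≤ (g x + 1) * (|L s| + ℓ) * ‖x - z‖ :=
    mul_le_mul_of_nonneg_right h4 (norm_nonneg _)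
  rw [norm_sub_rev z x] at h1
  have h7 : (γ - κ) / 2 * ‖p x - z‖ ^ 2 ≤ m x (p x) s - m x x s + r (p x) - r x +
      (g x + 1) ^ 2 / (2 * γ) * (|L s| + ℓ) ^ 2 + γ / 2 * ‖p x - x‖ ^ 2 := by
    linarith
  have hb : 0 < γ - κ := sub_pos.2 hγ
  have h8 := hp.proxValue_le (by linarith [h.lt_rho]) z (hp x).1
  have h9 := mul_le_mul_of_nonneg_left h7 (div_pos h.rho_pos hb).le
  have e : ρ / (γ - κ) * ((γ - κ) / 2 * ‖p x - z‖ ^ 2) = ρ / 2 * ‖p x - z‖ ^ 2 := by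
    field_simp
  rw [e] at h9
  linarith

/-- Expected descent of the Moreau envelope along a step. -/
lemma lintegral_step_le [IsProbabilityMeasure μ] (h : IsStochasticModel μ D f r m g L ρ κ τ ℓ Λ)
    {p : E → E} (hp : IsProxMap D (fun y => f y + r y) ρ (ρ - (κ + τ)) p) {x : E} (hx : x ∈ D)
    {γ θ : ℝ} (hθ : 0 < θ) (hγ : κ + (g x + 1) * θ ≤ γ) {T : S → E} (hTD : ∀ s, T s ∈ D)
    (hT : ∀ᵐ s ∂μ, IsMinOn (fun y => m x y s + r y + γ / 2 * ‖y - x‖ ^ 2) D (T s)) :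
    ∫⁻ s, ENNReal.ofReal (proxValue (fun y => f y + r y) ρ p (T s) + Λ) ∂μ +
        ENNReal.ofReal (descentTerm ρ (ρ - (κ + τ)) κ γ p x) ≤
      ENNReal.ofReal (proxValue (fun y => f y + r y) ρ p x + Λ) +
        ENNReal.ofReal (ρ / 2 * (∫ s, (|L s| + ℓ) ^ 2 ∂μ) / θ ^ 2) := by
  have hρ := h.rho_pos
  have hκ := h.kappa_nonneg
  have hg1 : 0 < g x + 1 := by linarith [h.growth_nonneg x]
  have hgθ : 0 < (g x + 1) * θ := mul_pos hg1 hθ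
  have hb : 0 < γ - κ := by linarith
  have hγ0 : 0 < γ := by linarith
  have hσ : 0 < ρ - (κ + τ) := sub_pos.2 h.lt_rho
  have hlow : ∀ y, 0 ≤ proxValue (fun y => f y + r y) ρ p y + Λ := fun y => by
    have h1 := h.lower _ (hp y).1
    have h2 : 0 ≤ ρ / 2 * ‖p y - y‖ ^ 2 := by positivity
    unfold proxValue
    linarith
  let H : S → ℝ := fun s => f (p x) + r (p x) + ρ / (γ - κ) *
      (m x (p x) s - m x x s + r (p x) - r x + (g x + 1) ^ 2 / (2 * γ) * (|L s| + ℓ) ^ 2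
        + γ / 2 * ‖p x - x‖ ^ 2) + Λ
  have hTH : ∀ᵐ s ∂μ, proxValue (fun y => f y + r y) ρ p (T s) + Λ ≤ H s := by
    filter_upwards [h.conv, h.lip, hT] with s h1 h2 h3
    exact add_le_add_left
      (h.proxValue_step_le hp hx (h1 x hx) (h2 x) (sub_pos.1 hb) (hTD s) h3) Λ
  have i1 := h.integrable x hx _ (hp x).1
  have i2 := h.integrable x hx x hx
  have i3 := h.integrable_sq.const_mul ((g x + 1) ^ 2 / (2 * γ))
  have i4 : Integrable (fun s => m x (p x) s - m x x s) μ := i1.sub i2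
  have i5 : Integrable (fun s => m x (p x) s - m x x s + r (p x)) μ := i4.add (integrable_const _)
  have i6 : Integrable (fun s => m x (p x) s - m x x s + r (p x) - r x) μ :=
    i5.sub (integrable_const _)
  have i7 : Integrable (fun s => m x (p x) s - m x x s + r (p x) - r x +
      (g x + 1) ^ 2 / (2 * γ) * (|L s| + ℓ) ^ 2) μ := i6.add i3
  have i8 : Integrable (fun s => m x (p x) s - m x x s + r (p x) - r x +
      (g x + 1) ^ 2 / (2 * γ) * (|L s| + ℓ) ^ 2 + γ / 2 * ‖p x - x‖ ^ 2) μ :=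
    i7.add (integrable_const _)
  have i9 := i8.const_mul (ρ / (γ - κ))
  have i10 : Integrable (fun s => f (p x) + r (p x) + ρ / (γ - κ) *
      (m x (p x) s - m x x s + r (p x) - r x + (g x + 1) ^ 2 / (2 * γ) * (|L s| + ℓ) ^ 2
        + γ / 2 * ‖p x - x‖ ^ 2)) μ := (integrable_const _).add i9
  have hHi : Integrable H μ := i10.add (integrable_const _)
  have hH : ∫ s, H s ∂μ = f (p x) + r (p x) + ρ / (γ - κ) *
      (∫ s, m x (p x) s ∂μ - f x + r (p x) - r x + (g x + 1) ^ 2 / (2 * γ) *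
        ∫ s, (|L s| + ℓ) ^ 2 ∂μ + γ / 2 * ‖p x - x‖ ^ 2) + Λ := by
    simp only [H]
    rw [integral_add i10 (integrable_const _), integral_add (integrable_const _) i9,
      integral_const_mul, integral_add i7 (integrable_const _), integral_add i6 i3,
      integral_sub i5 (integrable_const _), integral_add i4 (integrable_const _),
      integral_sub i1 i2, integral_const_mul, h.exact x hx]
    simp
  have hJ : 0 ≤ ∫ s, (|L s| + ℓ) ^ 2 ∂μ := integral_nonneg fun _ => sq_nonneg _
  have hbound : ∫ s, H s ∂μ + descentTerm ρ (ρ - (κ + τ)) κ γ p x ≤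
      proxValue (fun y => f y + r y) ρ p x + Λ +
        ρ / 2 * (∫ s, (|L s| + ℓ) ^ 2 ∂μ) / θ ^ 2 := by
    have h1 := h.quad x hx _ (hp x).1
    rw [norm_sub_rev] at h1
    have h2 := (hp x).2 x hx
    rw [sub_self, norm_zero, norm_sub_rev x (p x)] at h2
    -- Growth at `p x` tested with `x` contributes `-(ρ + σ)/2`, with `σ = ρ - (κ + τ)`. After
    -- scaling by `ρ / (γ - κ)`, the first part rebuilds the envelope at `x` and `-σ` gives the
    -- descent.
    have h3 : ∫ s, m x (p x) s ∂μ - f x + r (p x) - r x + γ / 2 * ‖p x - x‖ ^ 2 ≤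
        ((γ - κ) / 2 - (ρ - (κ + τ))) * ‖p x - x‖ ^ 2 := by
      linarith
    have h4 := mul_le_mul_of_nonneg_left h3 (div_pos hρ hb).le
    have e4 : ρ / (γ - κ) * (((γ - κ) / 2 - (ρ - (κ + τ))) * ‖p x - x‖ ^ 2) =
        ρ / 2 * ‖p x - x‖ ^ 2 - ρ * (ρ - (κ + τ)) / (γ - κ) * ‖p x - x‖ ^ 2 := by
      field_simp
    -- Both `γ` and `γ - κ` dominate `(g x + 1) * θ`, so the growth factor cancels.
    have h5 : ρ / (γ - κ) * ((g x + 1) ^ 2 / (2 * γ)) ≤ ρ / 2 / θ ^ 2 := by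
      rw [div_mul_div_comm, div_div, div_le_div_iff₀ (by positivity) (by positivity)]
      have h6 : ((g x + 1) * θ) * ((g x + 1) * θ) ≤ (γ - κ) * γ := by
        gcongr <;> linarith
      nlinarith [mul_le_mul_of_nonneg_left h6 hρ.le]
    have h7 := mul_le_mul_of_nonneg_right h5 hJ
    rw [hH]
    unfold descentTerm proxValue
    rw [e4] at h4
    have e8 : ρ / 2 * (∫ s, (|L s| + ℓ) ^ 2 ∂μ) / θ ^ 2 =
        ρ / 2 / θ ^ 2 * ∫ s, (|L s| + ℓ) ^ 2 ∂μ := by ring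
    rw [e8]
    linarith
  have hd : 0 ≤ descentTerm ρ (ρ - (κ + τ)) κ γ p x := by
    unfold descentTerm
    positivity
  have hH0 : 0 ≤ᵐ[μ] H := by
    filter_upwards [hTH] with s hs using (hlow _).trans hs
  calc _ ≤ ∫⁻ s, ENNReal.ofReal (H s) ∂μ +
        ENNReal.ofReal (descentTerm ρ (ρ - (κ + τ)) κ γ p x) := by
        gcongr ?_ + _
        exact lintegral_mono_ae (hTH.mono fun s hs => ENNReal.ofReal_le_ofReal hs)
    _ = ENNReal.ofReal (∫ s, H s ∂μ + descentTerm ρ (ρ - (κ + τ)) κ γ p x) := by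
        rw [← ofReal_integral_eq_lintegral_ofReal hHi hH0,
          ← ENNReal.ofReal_add (integral_nonneg_of_ae hH0) hd]
    _ ≤ _ := by
        rw [← ENNReal.ofReal_add (hlow x) (by positivity)]
        exact ENNReal.ofReal_le_ofReal hbound

end IsStochasticModel

end StochasticModel

/-! ### Iterates and their filtration -/

section Iterates

variable {E S Ω : Type*} [MeasurableSpace E] [MeasurableSpace S] {mΩ : MeasurableSpace Ω}

/-- The iterates generated by update maps `T k` and samples `Y k`, started at `x₁`. -/
def iterates (T : ℕ → E × S → E) (Y : ℕ → Ω → S) (x₁ : E) : ℕ → Ω → E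
  | 0, _ => x₁
  | k + 1, w => T k (iterates T Y x₁ k w, Y k w)

/-- The information carried by the first `k` samples. -/
def sampleFiltration (Y : ℕ → Ω → S)
    (hY : ∀ k, Measurable (Y k)) : Filtration ℕ mΩ where
  seq k := ⨆ j ∈ Set.Iio k, MeasurableSpace.comap (Y j) inferInstance
  mono' _ _ hkl := biSup_mono fun _ hj => lt_of_lt_of_le hj hkl
  le' _ := iSup₂_le fun j _ => (hY j).comap_le

lemma measurable_iterates {T : ℕ → E × S → E} (hT : ∀ k, Measurable (T k)) {Y : ℕ → Ω → S}
    (hY : ∀ k, Measurable (Y k)) (x₁ : E) (k : ℕ) :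
    Measurable[sampleFiltration Y hY k] (iterates T Y x₁ k) := by
  induction k with
  | zero => exact measurable_const
  | succ k ih =>
    have h1 : Measurable[sampleFiltration Y hY (k + 1)] (iterates T Y x₁ k) :=
      ih.mono ((sampleFiltration Y hY).mono k.le_succ) le_rfl
    have h2 : Measurable[sampleFiltration Y hY (k + 1)] (Y k) :=
      (comap_measurable (Y k)).mono
        (le_biSup (fun j => MeasurableSpace.comap (Y j) inferInstance)
          (Set.mem_Iio.2 k.lt_succ_self)) le_rfl
    exact (hT k).comp (h1.prodMk h2)

/-- Stage `k` of the filtration uses only indices strictly below `k`. -/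
lemma indep_sampleFiltration {Y : ℕ → Ω → S} (hY : ∀ k, Measurable (Y k)) {P : Measure Ω}
    (hind : iIndepFun Y P) (k : ℕ) :
    Indep (sampleFiltration Y hY k) (MeasurableSpace.comap (Y k) inferInstance) P := by
  have := indep_iSup_of_disjoint (fun j => (hY j).comap_le) hind
    (S := Set.Iio k) (T := {k}) (by simp)
  rw [iSup_singleton] at this
  exact this

end Iterates

/-! ### Almost sure bounds along the iterates -/

section BoundedIterates

variable {E S : Type*} [NormedAddCommGroup E] [InnerProductSpace ℝ E] [ProperSpace E]
  [MeasurableSpace E] [BorelSpace E] [MeasurableSpace S]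
  {μ : Measure S} {D : Set E} {f r : E → ℝ} {m : E → E → S → ℝ} {g : E → ℝ} {L : S → ℝ}
  {ρ κ τ ℓ Λ : ℝ}

/-- The update map of the method can be chosen jointly measurable in the iterate and the sample. -/
lemma IsStochasticModel.exists_measurable_step (h : IsStochasticModel μ D f r m g L ρ κ τ ℓ Λ)
    {γ : E → ℝ} (hγc : Continuous γ) (hγ : ∀ x, κ < γ x) :
    ∃ T : E × S → E, Measurable T ∧ (∀ q, T q ∈ D) ∧ ∀ᵐ s ∂μ, ∀ x ∈ D,
      IsMinOn (fun y => m x y s + r y + γ x / 2 * ‖y - x‖ ^ 2) D (T (x, s)) := by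
  -- The selection needs a measurable parameter set, so the good samples are cut down to a
  -- measurable set of full measure.
  obtain ⟨S₀, hS₀, hS₀m, hgood⟩ := (h.conv.and h.lip).exists_measurable_mem
  obtain ⟨T, hTm, hTD, hT⟩ := exists_measurable_argmin h.nonempty
    (Φ := fun (q : E × S) y => m q.1 y q.2 + r y + γ q.1 / 2 * ‖y - q.1‖ ^ 2) (K := D ×ˢ S₀)
    (fun y _ => by
      have h1 : Measurable fun q : E × S => m q.1 y q.2 :=
        h.measurable.comp (g := fun q : E × E × S => m q.1 q.2.1 q.2.2)
          (f := fun q : E × S => (q.1, y, q.2)) (by fun_prop)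
      have h2 : Continuous fun x : E => γ x / 2 * ‖y - x‖ ^ 2 := by fun_prop
      exact (h1.add_const _).add (h2.measurable.comp measurable_fst))
    (h.isClosed.measurableSet.prod hS₀m)
    (fun q hq => h.continuousOn_step ((hgood q.2 hq.2).2 q.1) _)
    (fun q hq => by
      obtain ⟨z, hz, hmin⟩ := h.exists_isMinOn_step hq.1 ((hgood q.2 hq.2).2 q.1)
        (h.kappa_nonneg.trans_lt (hγ q.1))
      exact ⟨z, hz, (γ q.1 - κ) / 2, half_pos (sub_pos.2 (hγ q.1)), fun y hy =>
        (h.strongConvexOn_step ((hgood q.2 hq.2).1 q.1 hq.1) _).quadratic_growth hz hmin hy⟩)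
  refine ⟨T, hTm, hTD, ?_⟩
  filter_upwards [hS₀] with s hs x hx using hT (x, s) ⟨hx, hs⟩

variable {Ω : Type*} {mΩ : MeasurableSpace Ω} {P : Measure Ω}

/-- The Moreau envelope along the iterates and the accumulated descent are almost surely bounded. -/
theorem IsStochasticModel.ae_bounded_iterates [IsProbabilityMeasure μ] [IsProbabilityMeasure P]
    (h : IsStochasticModel μ D f r m g L ρ κ τ ℓ Λ) {p : E → E}
    (hp : IsProxMap D (fun y => f y + r y) ρ (ρ - (κ + τ)) p) {Y : ℕ → Ω → S}
    (hY : ∀ k, Measurable (Y k)) (hlaw : ∀ k, P.map (Y k) = μ) (hind : iIndepFun Y P)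
    {γ : ℕ → E → ℝ} (hγc : ∀ k, Continuous (γ k)) {θ : ℕ → ℝ} (hθ : ∀ k, 0 < θ k)
    (hγ : ∀ k x, κ + (g x + 1) * θ k ≤ γ k x) (hsum : Summable fun k => 1 / θ k ^ 2)
    {T : ℕ → E × S → E} (hTm : ∀ k, Measurable (T k)) (hTD : ∀ k q, T k q ∈ D)
    (hT : ∀ k, ∀ᵐ s ∂μ, ∀ x ∈ D,
      IsMinOn (fun y => m x y s + r y + γ k x / 2 * ‖y - x‖ ^ 2) D (T k (x, s)))
    {x₁ : E} (hx₁ : x₁ ∈ D) :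
    ∀ᵐ w ∂P, ∃ B, ∀ k, proxValue (fun y => f y + r y) ρ p (iterates T Y x₁ k w) + Λ +
      ∑ i ∈ Finset.range k, descentTerm ρ (ρ - (κ + τ)) κ (γ i (iterates T Y x₁ i w)) p
        (iterates T Y x₁ i w) ≤ B := by
  have hρ := h.rho_pos
  have hσ : 0 < ρ - (κ + τ) := sub_pos.2 h.lt_rho
  have hγκ : ∀ k x, 0 < γ k x - κ := fun k x => by
    have := mul_pos (by linarith [h.growth_nonneg x] : 0 < g x + 1) (hθ k)
    linarith [hγ k x]
  have hpc : Continuous p := by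
    refine (LipschitzWith.of_dist_le_mul (K := Real.toNNReal (ρ / (ρ - (κ + τ))))
      fun x y => ?_).continuous
    rw [Real.coe_toNNReal _ (div_pos hρ hσ).le, dist_eq_norm, dist_eq_norm]
    exact hp.norm_sub_le hρ hσ y x
  have hVc : Continuous (proxValue (fun y => f y + r y) ρ p) :=
    continuous_iff_continuousAt.2 fun x => (hp.hasGradientAt hρ hσ x).continuousAt
  have hdc : ∀ k, Continuous fun x => descentTerm ρ (ρ - (κ + τ)) κ (γ k x) p x := fun k => by
    have := hγc k
    have h0 : ∀ x, γ k x - κ ≠ 0 := fun x => (hγκ k x).ne'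
    unfold descentTerm
    fun_prop (disch := assumption)
  have hXD : ∀ k w, iterates T Y x₁ k w ∈ D := by
    intro k w
    cases k with
    | zero => exact hx₁
    | succ k => exact hTD k _
  have hXm := measurable_iterates hTm hY x₁
  refine ae_bounded_of_almost_supermartingale (ℱ := sampleFiltration Y hY)
    (c := fun k => ρ / 2 * (∫ s, (|L s| + ℓ) ^ 2 ∂μ) / θ k ^ 2)
    (V := fun k w => proxValue (fun y => f y + r y) ρ p (iterates T Y x₁ k w) + Λ)
    (a := fun k w => descentTerm ρ (ρ - (κ + τ)) κ (γ k (iterates T Y x₁ k w)) p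
        (iterates T Y x₁ k w))
    (fun k => (hVc.measurable.add_const Λ).comp (hXm k)) (fun k => (hdc k).measurable.comp (hXm k))
    (fun k w => ?_) (fun k w => ?_) (fun k => ?_) ?_ ?_ (fun k A hA => ?_)
  · have h1 := h.lower _ (hp (iterates T Y x₁ k w)).1
    unfold proxValue
    have h2 : 0 ≤ ρ / 2 * ‖p (iterates T Y x₁ k w) - iterates T Y x₁ k w‖ ^ 2 := by positivity
    linarith
  · have := hγκ k (iterates T Y x₁ k w)
    unfold descentTerm
    positivity
  · have : 0 ≤ ∫ s, (|L s| + ℓ) ^ 2 ∂μ := integral_nonneg fun _ => sq_nonneg _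
    positivity
  · simpa only [mul_one_div] using hsum.mul_left (ρ / 2 * ∫ s, (|L s| + ℓ) ^ 2 ∂μ)
  · simp [iterates]
  · have hAm : MeasurableSet A := (sampleFiltration Y hY).le k A hA
    have h1 := setLIntegral_comp_of_indep ((sampleFiltration Y hY).le k) (hXm k) (hY k)
      (indep_sampleFiltration hY hind k)
      (h := fun q => ENNReal.ofReal (proxValue (fun y => f y + r y) ρ p (T k q) + Λ))
      (((hVc.measurable.comp (hTm k)).add_const Λ).ennreal_ofReal) hA
    have hXk : Measurable (iterates T Y x₁ k) := (hXm k).mono ((sampleFiltration Y hY).le k) le_rfl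
    rw [hlaw k] at h1
    simp only [iterates]
    have hdm : Measurable fun w => ENNReal.ofReal (descentTerm ρ (ρ - (κ + τ)) κ
        (γ k (iterates T Y x₁ k w)) p (iterates T Y x₁ k w)) :=
      ((hdc k).measurable.comp hXk).ennreal_ofReal
    rw [h1, ← lintegral_add_right _ hdm,
      ← setLIntegral_const, ← lintegral_add_right _ measurable_const]
    refine lintegral_mono fun w => ?_
    refine h.lintegral_step_le hp (hXD k w) (hθ k) (hγ k _) (fun s => hTD k _) ?_
    filter_upwards [hT k] with s hs using hs _ (hXD k w)

end BoundedIterates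

/-! ### Running minima -/

section RunningMinimum

/-- If the weighted sums of squares of `d` are bounded and the weights are not summable, then the
running minimum of `d` tends to zero. -/
lemma tendsto_iInf_Icc_zero_of_sum_le {d q : ℕ → ℝ} (hd : ∀ k, 0 ≤ d k) (hq : ∀ k, 0 ≤ q k)
    (hns : ¬ Summable q) {B : ℝ} (hB : ∀ k, ∑ i ∈ Finset.range k, q i * d (i + 1) ^ 2 ≤ B) :
    Tendsto (fun k : ℕ => ⨅ j : Set.Icc 1 k, d j) atTop (𝓝 0) := by
  have hex : ∀ ε > 0, ∃ j, 1 ≤ j ∧ d j < ε := by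
    intro ε hε
    by_contra! hcon
    have h1 : Summable fun i => q i * d (i + 1) ^ 2 :=
      summable_of_sum_range_le (fun i => mul_nonneg (hq i) (sq_nonneg _)) hB
    have h2 : Summable fun i => q i * ε ^ 2 :=
      Summable.of_nonneg_of_le (fun i => mul_nonneg (hq i) (sq_nonneg _))
        (fun i => mul_le_mul_of_nonneg_left
          (pow_le_pow_left₀ hε.le (hcon _ (Nat.le_add_left 1 i)) 2) (hq i)) h1
    exact hns ((summable_mul_right_iff (pow_pos hε 2).ne').1 h2)
  rw [Metric.tendsto_atTop]
  intro ε hε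
  obtain ⟨j, hj, hjε⟩ := hex ε hε
  -- One small value suffices: it enters every later infimum.
  refine ⟨j, fun k hk => ?_⟩
  have h0 : 0 ≤ ⨅ i : Set.Icc 1 k, d i := Real.iInf_nonneg fun i => hd i
  have h1 : ⨅ i : Set.Icc 1 k, d i ≤ d j :=
    ciInf_le (f := fun i : Set.Icc 1 k => d i) ⟨0, by rintro _ ⟨i, rfl⟩; exact hd i⟩ ⟨j, hj, hk⟩
  rw [Real.dist_eq, sub_zero, abs_of_nonneg h0]
  exact h1.trans_lt hjε

end RunningMinimum

/-! ### From extended-real to real-valued problems -/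

section ExtendedReal

variable {n : ℕ}

/-- A lower semicontinuous function that is Lipschitz on its effective domain has closed effective
domain. -/
lemma isClosed_effDomain {ω : Euc n → EReal} (hbot : ∀ x, ω x ≠ ⊥) (hlsc : LowerSemicontinuous ω)
    {K : ℝ≥0} (hlip : LipschitzOnWith K (fun x => (ω x).toReal) (effDomain ω)) :
    IsClosed (effDomain ω) := by
  refine isClosed_of_closure_subset fun x hx => ?_
  obtain ⟨y, hy, hxy⟩ := Metric.mem_closure_iff.1 hx 1 one_pos
  -- Domain points within `1` of `x` are within `2` of `y`, so they lie in a closed sublevel set,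
  -- which then contains `x`.
  let M : ℝ := (ω y).toReal + K * 2
  have hsub : effDomain ω ∩ Metric.ball x 1 ⊆ ω ⁻¹' Set.Iic (M : EReal) := by
    rintro z ⟨hz, hzx⟩
    have h1 := hlip.dist_le_mul z hz y hy
    have h2 : dist z y ≤ 2 := by
      have := dist_triangle z x y
      have := Metric.mem_ball.1 hzx
      linarith
    have h3 : (K : ℝ) * dist z y ≤ K * 2 := by gcongr
    have h4 := (abs_le.1 ((Real.dist_eq _ _).symm.le.trans h1)).2
    rw [Set.mem_preimage, Set.mem_Iic, ← EReal.coe_toReal hz (hbot z), EReal.coe_le_coe_iff]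
    linarith
  have hcl : IsClosed (ω ⁻¹' Set.Iic (M : EReal)) := hlsc.isClosed_preimage _
  have hmem : x ∈ closure (effDomain ω ∩ Metric.ball x 1) := by
    rw [Set.inter_comm]
    exact Metric.isOpen_ball.inter_closure ⟨Metric.mem_ball_self one_pos, hx⟩
  have := hcl.closure_subset_iff.2 hsub hmem
  exact ((lt_of_le_of_lt this (EReal.coe_lt_top M)).ne : ω x ≠ ⊤)

variable {S : Type*} [MeasurableSpace S] {μ : Measure S} {F : Euc n → S → ℝ} {ω : Euc n → EReal}

lemma objective_of_mem (hbot : ∀ x, ω x ≠ ⊥) {y : Euc n} (hy : y ∈ effDomain ω) :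
    objective μ F ω y = ((expectedLoss μ F y + (ω y).toReal : ℝ) : EReal) := by
  rw [EReal.coe_add, EReal.coe_toReal hy (hbot y), objective]

lemma objective_of_notMem {y : Euc n} (hy : y ∉ effDomain ω) : objective μ F ω y = ⊤ := by
  have : ω y = ⊤ := not_not.1 hy
  rw [objective, this, EReal.coe_add_top]

lemma moreauEnv_eq_coe_proxValue (hbot : ∀ x, ω x ≠ ⊥) {ρ σ : ℝ} (hσ : 0 < σ) {p : Euc n → Euc n}
    (hp : IsProxMap (effDomain ω) (fun y => expectedLoss μ F y + (ω y).toReal) ρ σ p) (x : Euc n) :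
    moreauEnv (objective μ F ω) ρ x =
      (proxValue (fun y => expectedLoss μ F y + (ω y).toReal) ρ p x : EReal) := by
  refine le_antisymm ((iInf_le _ (p x)).trans (le_of_eq ?_)) (le_iInf fun z => ?_)
  · rw [objective_of_mem hbot (hp x).1, ← EReal.coe_add, proxValue]
  · by_cases hz : z ∈ effDomain ω
    · rw [objective_of_mem hbot hz, ← EReal.coe_add, EReal.coe_le_coe_iff]
      exact hp.proxValue_le hσ x hz
    · rw [objective_of_notMem hz, EReal.top_add_coe]
      exact le_top

lemma subproblem_of_mem {S : Type*} {m : Euc n → Euc n → S → ℝ} (hbot : ∀ x, ω x ≠ ⊥)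
    {y : Euc n} (hy : y ∈ effDomain ω) (γ : ℝ) (x : Euc n) (s : S) :
    subproblem m ω γ x s y = ((m x y s + (ω y).toReal + γ / 2 * ‖y - x‖ ^ 2 : ℝ) : EReal) := by
  rw [EReal.coe_add, EReal.coe_add, EReal.coe_toReal hy (hbot y), subproblem]

/-- A minimizer of the extended-real subproblem lies in the effective domain and minimizes the
real-valued subproblem there. -/
lemma isMinOn_of_isMinOn_subproblem {S : Type*} {m : Euc n → Euc n → S → ℝ}
    (hω : IsProperFun ω) {γ : ℝ} {x z : Euc n} {s : S}
    (h : IsMinOn (subproblem m ω γ x s) Set.univ z) :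
    z ∈ effDomain ω ∧
      IsMinOn (fun y => m x y s + (ω y).toReal + γ / 2 * ‖y - x‖ ^ 2) (effDomain ω) z := by
  have hz : z ∈ effDomain ω := by
    obtain ⟨y, hy⟩ := hω.2
    intro htop
    have h1 : subproblem m ω γ x s z ≤ subproblem m ω γ x s y := h (Set.mem_univ y)
    rw [subproblem_of_mem hω.1 hy, subproblem, htop, EReal.coe_add_top, EReal.top_add_coe] at h1
    exact (EReal.coe_lt_top _).not_ge h1
  refine ⟨hz, fun y hy => ?_⟩
  have h1 : subproblem m ω γ x s z ≤ subproblem m ω γ x s y := h (Set.mem_univ y)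
  rw [subproblem_of_mem hω.1 hy, subproblem_of_mem hω.1 hz, EReal.coe_le_coe_iff] at h1
  exact h1

end ExtendedReal

/-! ### The regularization parameter -/

section StepParameter

variable {n : ℕ}

lemma continuous_stepParam (ρ κ ζ : ℝ) {G : ℝ≥0 → ℝ≥0} (hG : Continuous G) (k : ℕ) :
    Continuous (stepParam (n := n) ρ κ ζ G k) := by
  unfold stepParam
  fun_prop

/-- Since `(k + 1)^ζ ≥ 1`, the denominator is at most `(a + b) (k + 1)^ζ`; compare with the
divergent `p`-series. -/
lemma not_summable_const_div_rpow {c a b ζ : ℝ} (hc : 0 < c) (ha : 0 ≤ a) (hb : 0 < b) (h0 : 0 ≤ ζ)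
    (h1 : ζ ≤ 1) : ¬ Summable fun k : ℕ => c / (a + b * ((k + 1 : ℕ) : ℝ) ^ ζ) := by
  intro h
  have h2 : Summable fun k : ℕ => c / (a + b) * (1 / ((k + 1 : ℕ) : ℝ) ^ ζ) := by
    refine Summable.of_nonneg_of_le (fun k => by positivity) (fun k => ?_) h
    have h3 : (1 : ℝ) ≤ ((k + 1 : ℕ) : ℝ) ^ ζ := Real.one_le_rpow (by simp) h0
    rw [div_mul_div_comm, mul_one, add_mul]
    gcongr
    exact le_mul_of_one_le_right ha h3
  have h4 := (summable_mul_left_iff (by positivity : c / (a + b) ≠ 0)).1 h2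
  have h5 := (summable_nat_add_iff (f := fun k : ℕ => 1 / (k : ℝ) ^ ζ) 1).1 h4
  exact h1.not_gt (Real.summable_one_div_nat_rpow.1 h5)

end StepParameter

/-! ### The convergence theorem -/

theorem theorem4p1 {n : ℕ} {S Ω : Type*} [MeasurableSpace S] [MeasurableSpace Ω]
    (μ : Measure S) [IsProbabilityMeasure μ] (P : Measure Ω) [IsProbabilityMeasure P]
    -- loss `F`, regularizer `ω`, model functions `m x y s = f_x (y, s)`
    (F : Euc n → S → ℝ) (ω : Euc n → EReal) (m : Euc n → Euc n → S → ℝ)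
    (ρ κ τ ζ Λ : ℝ) (Lω : ℝ≥0) (Lfun : S → ℝ) (Lf : ℝ) (G : ℝ≥0 → ℝ≥0)
    -- i.i.d. samples `ξ 1, ξ 2, …` with law `μ`
    (ξ : ℕ → Ω → S) (hξ_meas : ∀ k, 1 ≤ k → Measurable (ξ k))
    (hξ_law : ∀ k, 1 ≤ k → P.map (ξ k) = μ)
    (hξ_indep : iIndepFun (fun k : ℕ => ξ (k + 1)) P)
    -- the regularizer
    (hω_proper : IsProperFun ω) (hω_lsc : LowerSemicontinuous ω)
    (hω_conv : IsWeaklyConvex κ ω)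
    (hω_lip : LipschitzOnWith Lω (fun x => (ω x).toReal) (effDomain ω))
    -- the loss and the stochastic models
    (hF_int : ∀ x ∈ effDomain ω, Integrable (F x) μ)
    (hm_meas : Measurable (fun p : Euc n × Euc n × S => m p.1 p.2.1 p.2.2))
    (hm_int : ∀ x ∈ effDomain ω, ∀ y ∈ effDomain ω, Integrable (m x y) μ)
    (hm_exact : ∀ x ∈ effDomain ω, ∫ s, m x x s ∂μ = expectedLoss μ F x)
    (hτ : 0 ≤ τ)
    (hm_quad : ∀ x ∈ effDomain ω, ∀ y ∈ effDomain ω,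
      ∫ s, (m x y s - expectedLoss μ F y) ∂μ ≤ τ / 2 * ‖x - y‖ ^ 2)
    (hm_conv : ∀ᵐ s ∂μ, ∀ x ∈ effDomain ω, ConvexOn ℝ (effDomain ω) (fun y => m x y s))
    -- the growth condition
    (hG_cont : Continuous G) (hG_mono : Monotone G)
    (hm_lip : ∀ᵐ s ∂μ, ∀ x y z, m x y s - m x z s ≤ Lfun s * (G ‖x‖₊ : ℝ) * ‖y - z‖)
    (hL_mem : MemLp Lfun 2 μ) (hL_sq : ∫ s, Lfun s ^ 2 ∂μ ≤ Lf ^ 2)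
    -- the Moreau envelope of the objective is bounded below and has bounded level sets
    (hρ : κ + τ < ρ) (hΛ : 0 ≤ Λ)
    (h_lower : ∀ x, ((-Λ : ℝ) : EReal) ≤ moreauEnv (objective μ F ω) ρ x)
    (h_level : ∀ v : ℝ, Bornology.IsBounded {x | moreauEnv (objective μ F ω) ρ x ≤ (v : EReal)})
    -- the iterates `x 1 = x₁, x 2, x 3, …`
    (hζ : ζ ∈ Set.Ioo (1 / 2 : ℝ) 1)
    (x₁ : Euc n) (hx₁ : x₁ ∈ effDomain ω) (x : ℕ → Ω → Euc n)
    (hx_init : ∀ᵐ w ∂P, x 1 w = x₁)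
    (hx_step : ∀ᵐ w ∂P, ∀ k, 1 ≤ k →
      IsMinOn (subproblem m ω (stepParam ρ κ ζ G k (x k w)) (x k w) (ξ k w))
        Set.univ (x (k + 1) w)) :
    -- the Moreau envelope is finite and differentiable, so its gradient makes sense
    (∀ y, moreauEnv (objective μ F ω) ρ y ≠ ⊥ ∧ moreauEnv (objective μ F ω) ρ y ≠ ⊤) ∧
    Differentiable ℝ (fun y => (moreauEnv (objective μ F ω) ρ y).toReal) ∧
    -- almost surely the iterates are bounded
    (∀ᵐ w ∂P, ∃ B : ℝ, ∀ k, 1 ≤ k → ‖x k w‖ ≤ B) ∧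
    -- almost surely the smallest gradient norm so far tends to zero
    (∀ᵐ w ∂P, Tendsto
      (fun k : ℕ => ⨅ j : Set.Icc 1 k,
        ‖gradient (fun y => (moreauEnv (objective μ F ω) ρ y).toReal) (x j w)‖)
      atTop (𝓝 0)) := by
  have hρ0 : 0 < ρ := by linarith [hω_conv.1]
  have hσ : 0 < ρ - (κ + τ) := sub_pos.2 hρ
  have h : IsStochasticModel μ (effDomain ω) (expectedLoss μ F) (fun y => (ω y).toReal) m
      (fun y => (G ‖y‖₊ : ℝ)) Lfun ρ κ τ Lω Λ :=
    { nonempty := hω_proper.2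
      isClosed := isClosed_effDomain hω_proper.1 hω_lsc hω_lip
      kappa_nonneg := hω_conv.1
      tau_nonneg := hτ
      lip_nonneg := Lω.2
      lt_rho := hρ
      reg_conv := by
        rw [strongConvexOn_iff_convex]
        refine hω_conv.2.congr fun y _ => ?_
        ring
      reg_lip := fun y hy z hz => by
        have := hω_lip.dist_le_mul y hy z hz
        rw [Real.dist_eq, dist_eq_norm] at this
        exact (le_abs_self _).trans this
      measurable := hm_meas
      integrable := hm_int
      exact := hm_exact
      quad := fun y hy z hz => by
        have := hm_quad y hy z hz
        rw [integral_sub (hm_int y hy z hz) (integrable_const _), integral_const] at this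
        simp only [probReal_univ, one_smul] at this
        linarith
      conv := hm_conv
      lip := by
        filter_upwards [hm_lip] with s hs y z u
        refine (hs y z u).trans ?_
        gcongr
        exact le_abs_self _
      growth_cont := by fun_prop
      growth_nonneg := fun y => NNReal.coe_nonneg _
      memLp := hL_mem
      lower := fun y hy => by
        have h1 := (h_lower y).trans (iInf_le _ y)
        rw [objective_of_mem hω_proper.1 hy, ← EReal.coe_add, EReal.coe_le_coe_iff] at h1
        simpa using h1 }
  obtain ⟨p, hp⟩ := h.exists_prox
  have henv := moreauEnv_eq_coe_proxValue (μ := μ) (F := F) hω_proper.1 hσ hp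
  have henv' : (fun y => (moreauEnv (objective μ F ω) ρ y).toReal) =
      proxValue (fun y => expectedLoss μ F y + (ω y).toReal) ρ p := by
    funext y
    rw [henv, EReal.toReal_coe]
  have hgrad := hp.hasGradientAt hρ0 hσ
  have hθ : ∀ k : ℕ, 0 < ((k + 1 : ℕ) : ℝ) ^ ζ := fun k => by positivity
  have hγ : ∀ (k : ℕ) (y : Euc n),
      κ + ((G ‖y‖₊ : ℝ) + 1) * ((k + 1 : ℕ) : ℝ) ^ ζ ≤ stepParam ρ κ ζ G (k + 1) y := fun k y => by
    unfold stepParam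
    linarith
  have hγκ : ∀ (k : ℕ) (y : Euc n), κ < stepParam ρ κ ζ G (k + 1) y := fun k y => by
    have := mul_pos (by positivity : (0 : ℝ) < (G ‖y‖₊ : ℝ) + 1) (hθ k)
    linarith [hγ k y]
  have hsum : Summable fun k : ℕ => 1 / (((k + 1 : ℕ) : ℝ) ^ ζ) ^ 2 := by
    have h1 := (summable_nat_add_iff (f := fun k : ℕ => 1 / (k : ℝ) ^ (ζ * 2)) 1).2
      (Real.summable_one_div_nat_rpow.2 (by linarith [hζ.1]))
    refine h1.congr fun k => ?_
    rw [Real.rpow_mul (Nat.cast_nonneg _), Real.rpow_ofNat]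
  choose T hTm hTD hT using fun k : ℕ => h.exists_measurable_step
    (continuous_stepParam ρ κ ζ hG_cont (k + 1)) (hγκ k)
  -- The abstract process starts at `0`: its state `k` is `x (k + 1)` and its sample `k` is `ξ (k +
  -- 1)`.
  have hbound := h.ae_bounded_iterates hp (Y := fun k => ξ (k + 1))
    (fun k => hξ_meas _ (Nat.le_add_left 1 k)) (fun k => hξ_law _ (Nat.le_add_left 1 k)) hξ_indep
    (fun k => continuous_stepParam ρ κ ζ hG_cont (k + 1)) hθ hγ hsum hTm hTD hT hx₁
  have hsamples : ∀ᵐ w ∂P, ∀ k, ∀ y ∈ effDomain ω,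
      ConvexOn ℝ (effDomain ω) (fun z => m y z (ξ (k + 1) w)) ∧
      IsMinOn (fun z => m y z (ξ (k + 1) w) + (ω z).toReal +
        stepParam ρ κ ζ G (k + 1) y / 2 * ‖z - y‖ ^ 2) (effDomain ω) (T k (y, ξ (k + 1) w)) := by
    refine ae_all_iff.2 fun k => ?_
    have h1 : ∀ᵐ s ∂(P.map (ξ (k + 1))), ∀ y ∈ effDomain ω,
        ConvexOn ℝ (effDomain ω) (fun z => m y z s) ∧
        IsMinOn (fun z => m y z s + (ω z).toReal +
          stepParam ρ κ ζ G (k + 1) y / 2 * ‖z - y‖ ^ 2) (effDomain ω) (T k (y, s)) := by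
      rw [hξ_law _ (Nat.le_add_left 1 k)]
      filter_upwards [hm_conv, hT k] with s h1 h2 y hy using ⟨h1 y hy, h2 y hy⟩
    exact ae_of_ae_map (hξ_meas _ (Nat.le_add_left 1 k)).aemeasurable h1
  have hiter : ∀ᵐ w ∂P, ∀ k,
      iterates T (fun k => ξ (k + 1)) x₁ k w = x (k + 1) w ∧ x (k + 1) w ∈ effDomain ω := by
    filter_upwards [hx_init, hx_step, hsamples] with w h1 h2 h3 k
    induction k with
    | zero => exact ⟨h1.symm, by rwa [zero_add, h1]⟩
    | succ k ih =>
      obtain ⟨hD, hmin⟩ :=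
        isMinOn_of_isMinOn_subproblem hω_proper (h2 (k + 1) (Nat.le_add_left 1 k))
      obtain ⟨hconv, hminT⟩ := h3 k _ ih.2
      refine ⟨?_, hD⟩
      rw [iterates, ih.1]
      exact (h.strongConvexOn_step hconv _).eq_of_isMinOn (sub_pos.2 (hγκ k _)) (hTD k _) hminT
        hD hmin
  have hbound' : ∀ᵐ w ∂P, ∃ B R : ℝ, (∀ k, ‖x (k + 1) w‖ ≤ R) ∧
      ∀ k, ∑ i ∈ Finset.range k, descentTerm ρ (ρ - (κ + τ)) κ
        (stepParam ρ κ ζ G (i + 1) (x (i + 1) w)) p (x (i + 1) w) ≤ B := by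
    filter_upwards [hbound, hiter] with w ⟨B, hB⟩ hx
    simp only [fun k => (hx k).1] at hB
    have hd : ∀ k, 0 ≤ ∑ i ∈ Finset.range k, descentTerm ρ (ρ - (κ + τ)) κ
        (stepParam ρ κ ζ G (i + 1) (x (i + 1) w)) p (x (i + 1) w) := fun k =>
      Finset.sum_nonneg fun i _ => by
        have := sub_pos.2 (hγκ i (x (i + 1) w))
        unfold descentTerm
        positivity
    -- The bound `B` controls the envelope plus `Λ`, hence the level `B - Λ`.
    obtain ⟨R, hR⟩ := isBounded_iff_forall_norm_le.1 (h_level (B - Λ))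
    refine ⟨B, R, fun k => hR _ ?_, fun k => ?_⟩
    · rw [Set.mem_ofPred_eq, henv, EReal.coe_le_coe_iff]
      linarith [hB k, hd k]
    · have h1 := h_lower (x (k + 1) w)
      rw [henv, EReal.coe_le_coe_iff] at h1
      linarith [hB k]
  refine ⟨fun y => ?_, ?_, ?_, ?_⟩
  · rw [henv]
    exact ⟨EReal.coe_ne_bot _, EReal.coe_ne_top _⟩
  · rw [henv']
    exact fun y => (hgrad y).differentiableAt
  · filter_upwards [hbound'] with w ⟨B, R, hR, _⟩
    refine ⟨R, fun k hk => ?_⟩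
    obtain ⟨k, rfl⟩ := Nat.exists_eq_add_of_le' hk
    exact hR k
  · filter_upwards [hbound'] with w ⟨B, R, hR, hB⟩
    let M : ℝ := G R.toNNReal
    have hM : ∀ k, (G ‖x (k + 1) w‖₊ : ℝ) ≤ M := fun k =>
      NNReal.coe_le_coe.2 (hG_mono (by
        rw [← norm_toNNReal]
        exact Real.toNNReal_le_toNNReal (hR k)))
    have hM0 : 0 ≤ M := NNReal.coe_nonneg _
    have hζ0 : 0 ≤ ζ := by linarith [hζ.1]
    simp only [henv', (hgrad _).gradient]
    -- The squared gradient norm carries `ρ²`, so dividing the descent coefficient `ρ σ` by `ρ²`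
    -- leaves `σ / ρ`; `M` replaces the growth factor by its bound along this path.
    refine tendsto_iInf_Icc_zero_of_sum_le (d := fun k => ‖ρ • (x k w - p (x k w))‖)
      (q := fun k => (ρ - (κ + τ)) / ρ / (ρ + (M + 1) * ((k + 1 : ℕ) : ℝ) ^ ζ))
      (fun k => norm_nonneg _) (fun k => by positivity)
      (not_summable_const_div_rpow (by positivity) hρ0.le (by positivity) hζ0 hζ.2.le) (B := B)
      fun k => (Finset.sum_le_sum fun i _ => ?_).trans (hB k)
    rw [norm_smul, norm_sub_rev, Real.norm_of_nonneg hρ0.le, mul_pow, ← mul_assoc]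
    unfold descentTerm
    refine mul_le_mul_of_nonneg_right ?_ (sq_nonneg _)
    have e : (ρ - (κ + τ)) / ρ / (ρ + (M + 1) * ((i + 1 : ℕ) : ℝ) ^ ζ) * ρ ^ 2 =
        ρ * (ρ - (κ + τ)) / (ρ + (M + 1) * ((i + 1 : ℕ) : ℝ) ^ ζ) := by
      field_simp
    rw [e]
    refine div_le_div_of_nonneg_left (by positivity) (sub_pos.2 (hγκ i _)) ?_
    have := mul_le_mul_of_nonneg_right (hM i) (hθ i).le
    unfold stepParam
    linarith
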